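/- For $j\ge 1$ let $E_j=\prod_{n\ge 1}(1-q^{jn})$, and let the integers $c(n)$ be defined by $$\sum_{n\ge 0}c(n)q^n=\frac{E_5^4}{E_1}.$$ For $\alpha\ge 1$ put $\tilde\delta_\alpha=\frac{23\cdot 5^\alpha-19}{24}$ if $\alpha$ is odd and $\tilde\delta_\alpha=\frac{19(5^\alpha-1)}{24}$ if $\alpha$ is even. Let $M=(m_{i,j})_{i,j\ge1}$ be the infinite matrix whose first five rows are $$\begin{pmatrix}5&0&0&0&0&0&\cdots\\ 2\cdot5&5^3&0&0&0&0&\cdots\\ 9&3\cdot5^3&5^5&0&0&0&\cdots\\ 4&22\cdot5^2&4\cdot5^5&5^7&0&0&\cdots\\ 1&4\cdot5^3&8\cdot5^5&5^8&5^9&0&\cdots\end{pmatrix}$$ and which satisfies, for $i\ge6$, $m_{i,1}=0$ and, for $j\ge2$, $$m_{i,j}=25m_{i-1,j-1}+25m_{i-2,j-1}+15m_{i-3,j-1}+5m_{i-4,j-1}+m_{i-5,j-1}.$$ Let $\tilde A=(\tilde a_{i,j})_{i,j\ge1}$ and $\tilde B=(\tilde b_{i,j})_{i,j\ge1}$ with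 $\tilde a_{i,j}=m_{6i-4,\,i-1+j}$ and $\tilde b_{i,j}=m_{6i-5,\,i-1+j}$ (every column of $\tilde A$ and of $\tilde B$ has only finitely many nonzero entries). Define row vectors $\tilde{\mathbf x}_\alpha=(\tilde x_{\alpha,1},\tilde x_{\alpha,2},\dots)$ by $\tilde{\mathbf x}_1=(5,0,0,\dots)$ and, for $\alpha\ge1$, $\tilde{\mathbf x}_{\alpha+1}=\tilde{\mathbf x}_\alpha\tilde A$ if $\alpha$ is odd and $\tilde{\mathbf x}_{\alpha+1}=\tilde{\mathbf x}_\alpha\tilde B$ if $\alpha$ is even. Then, as identities of formal power series in $q$, for every $\alpha\ge1$, $$\sum_{n\ge0}c(5^\alpha n+\tilde\delta_\alpha)q^n=\sum_{i\ge1}\tilde x_{\alpha,i}\,q^{i-1}\frac{E_5^{6i-1}}{E_1^{6i-4}}\quad\text{if $\alpha$ is odd,}$$ $$\sum_{n\ge0}c(5^\alpha n+\tilde\delta_\alpha)q^n=\sum_{i\ge1}\tilde x_{\alpha,i}\,q^{i-1}\frac{E_5^{6i-2}}{E_1^{6i-5}}\quad\text{if $\alpha$ is even.}$$ -/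

import Mathlib

open scoped PowerSeries PowerSeries.WithPiTopology

namespace HirschhornHunt

open PowerSeries

/-- The Euler product `E_j(q) = ∏_{n ≥ 1} (1 - q^{j n})`, as a formal power series in `q = X`
with integer coefficients. The product converges in the usual topology of `ℤ⟦X⟧`
(coefficientwise convergence) for `j ≥ 1`, see `multipliable_eulerE`. -/
noncomputable def eulerE (j : ℕ) : ℤ⟦X⟧ :=
  ∏' n : ℕ, (1 - X ^ (j * (n + 1)))

/-- The reciprocal `1 / E_j` in `ℤ⟦X⟧`; see `eulerE_mul_eulerEInv`. -/
noncomputable def eulerEInv (j : ℕ) : ℤ⟦X⟧ :=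
  invOfUnit (eulerE j) 1

/-- `c(n)`: the coefficient of `q^n` in `E_5^4 / E_1`. -/
noncomputable def c (n : ℕ) : ℤ :=
  coeff n (eulerE 5 ^ 4 * eulerEInv 1)

/-- `δ_α = (23 * 5^α - 19) / 24` for odd `α` and `δ_α = 19 * (5^α - 1) / 24` for even `α`.
Both divisions are exact, see `delta_odd` and `delta_even`. -/
def delta (α : ℕ) : ℕ :=
  if Odd α then (23 * 5 ^ α - 19) / 24 else 19 * (5 ^ α - 1) / 24

/-- The entries `m_{i,j}` of the matrix `M`, with rows and columns numbered from `1`.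
(Row and column `0` are not part of `M`; they are filled with zeros and never used.) -/
def m : ℕ → ℕ → ℤ
  | 0, _ => 0
  | 1, j => [0, 5].getD j 0
  | 2, j => [0, 2 * 5, 5 ^ 3].getD j 0
  | 3, j => [0, 9, 3 * 5 ^ 3, 5 ^ 5].getD j 0
  | 4, j => [0, 4, 22 * 5 ^ 2, 4 * 5 ^ 5, 5 ^ 7].getD j 0
  | 5, j => [0, 1, 4 * 5 ^ 3, 8 * 5 ^ 5, 5 ^ 8, 5 ^ 9].getD j 0
  | _ + 6, 0 => 0
  | _ + 6, 1 => 0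
  | i + 6, j + 2 =>
      25 * m (i + 5) (j + 1) + 25 * m (i + 4) (j + 1) + 15 * m (i + 3) (j + 1)
        + 5 * m (i + 2) (j + 1) + m (i + 1) (j + 1)

/-- The matrix `A`, with entries `a_{i,j} = m_{6i-4, i-1+j}` for `i, j ≥ 1`. -/
def matA : Matrix ℕ+ ℕ+ ℤ := fun i j => m (6 * (i : ℕ) - 4) ((i : ℕ) - 1 + (j : ℕ))

/-- The matrix `B`, with entries `b_{i,j} = m_{6i-5, i-1+j}` for `i, j ≥ 1`. -/
def matB : Matrix ℕ+ ℕ+ ℤ := fun i j => m (6 * (i : ℕ) - 5) ((i : ℕ) - 1 + (j : ℕ))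

/-- The product `x T` of an infinite row vector and an infinite matrix. For `T = matA` or
`T = matB` every column has finite support, so that the sum is finite; see
`finite_support_mul_matA` and `finite_support_mul_matB`. -/
noncomputable def rowMul (x : ℕ+ → ℤ) (T : Matrix ℕ+ ℕ+ ℤ) : ℕ+ → ℤ :=
  fun j => ∑ᶠ i : ℕ+, x i * T i j

/-- The row vectors `x_α` for `α ≥ 1`: `x_1 = (5, 0, 0, …)`, and `x_{α+1}` is `x_α A` for odd `α`
and `x_α B` for even `α`. (The value at `α = 0` is not used.) -/
noncomputable def xVec : ℕ → ℕ+ → ℤ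
  | 0 => 0
  | 1 => fun i => if i = 1 then 5 else 0
  | α + 2 => if Odd (α + 1) then rowMul (xVec (α + 1)) matA else rowMul (xVec (α + 1)) matB

/-! ### The definitions above carry no junk values -/

theorem multipliable_eulerE {j : ℕ} (hj : 0 < j) :
    Multipliable fun n : ℕ => (1 - X ^ (j * (n + 1)) : ℤ⟦X⟧) := by
  simp_rw [sub_eq_add_neg]
  apply WithPiTopology.multipliable_one_add_of_tendsto_order_atTop_nhds_top
  refine ENat.tendsto_nhds_top_iff_natCast_lt.mpr
    (fun n => Filter.eventually_atTop.mpr ⟨n, fun k hk => ?_⟩)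
  rw [order_neg, order_X_pow]
  norm_cast
  nlinarith

theorem constantCoeff_eulerE {j : ℕ} (hj : 0 < j) : constantCoeff (eulerE j) = 1 := by
  have h := (multipliable_eulerE hj).map_tprod (constantCoeff (R := ℤ))
    (WithPiTopology.continuous_constantCoeff ℤ)
  rw [eulerE, h]
  simp [hj.ne']

theorem eulerE_mul_eulerEInv {j : ℕ} (hj : 0 < j) : eulerE j * eulerEInv j = 1 :=
  mul_invOfUnit _ _ (by simpa using constantCoeff_eulerE hj)

theorem delta_odd {α : ℕ} (h : Odd α) : 24 * delta α + 19 = 23 * 5 ^ α := by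
  obtain ⟨k, rfl⟩ := h
  have h1 : (25 ^ k) % 24 = 1 := by simp [Nat.pow_mod]
  have h2 : 5 ^ (2 * k + 1) = 5 * 25 ^ k := by rw [pow_succ, pow_mul]; norm_num [mul_comm]
  have h3 : Odd (2 * k + 1) := ⟨k, rfl⟩
  rw [delta, if_pos h3, h2]
  omega

theorem delta_even {α : ℕ} (h : Even α) : 24 * delta α = 19 * (5 ^ α - 1) := by
  obtain ⟨k, rfl⟩ := h
  have h1 : (25 ^ k) % 24 = 1 := by simp [Nat.pow_mod]
  have h2 : 5 ^ (k + k) = 25 ^ k := by rw [← two_mul, pow_mul]; norm_num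
  have h3 : ¬ Odd (k + k) := by simp
  rw [delta, if_neg h3, h2]
  omega

theorem m_eq_zero (i j : ℕ) (h : 5 * j < i) : m i j = 0 := by
  fun_induction m i j <;> grind

theorem finite_support_mul_matA (x : ℕ+ → ℤ) (j : ℕ+) :
    (Function.support fun i : ℕ+ => x i * matA i j).Finite := by
  refine (Set.finite_Iic (5 * j)).subset fun i hi => ?_
  by_contra hlt
  have h : ((5 * j : ℕ+) : ℕ) < i := PNat.coe_lt_coe _ _ |>.mpr (not_le.mp hlt)
  refine hi ?_
  have := i.pos
  simp only [PNat.mul_coe, PNat.val_ofNat] at h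
  simp only [matA]
  rw [m_eq_zero _ _ (by omega), mul_zero]

theorem finite_support_mul_matB (x : ℕ+ → ℤ) (j : ℕ+) :
    (Function.support fun i : ℕ+ => x i * matB i j).Finite := by
  refine (Set.finite_Iic (5 * j)).subset fun i hi => ?_
  by_contra hlt
  have h : ((5 * j : ℕ+) : ℕ) < i := PNat.coe_lt_coe _ _ |>.mpr (not_le.mp hlt)
  refine hi ?_
  have := i.pos
  simp only [PNat.mul_coe, PNat.val_ofNat] at h
  simp only [matB]
  rw [m_eq_zero _ _ (by omega), mul_zero]

end HirschhornHunt

namespace HirschhornHunt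

open PowerSeries

/-! Write b = qE_25, ζ = b/E_1 (`eulerQuot`), t = qE_5^6/E_1^6 (`eulerQuotSix`), and let U keep the
exponents divisible by 5 and replace q^5 by q (`section5 0`). Up to a factor that is a series in q^5
and a power of q, each term on the right-hand side is a power of ζ. One step α → α+1 therefore
reduces to U(ζ^i) = ∑_j m_{i,j} t^j (`section5_eulerQuot_pow`): row i of M is the expansion of
U(ζ^i) in powers of t.

That expansion follows from a quintic equation for ζ over series in q^5 (`eulerQuot_pow_five`),
which gives the recurrence of M, together with five seed values (`section5_X_mul_eulerE_pow_mul`).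
Both rest on the dissection E_1 = a - b + c, with exponents 0, 1, 2 mod 5, and on the relation ac =
-b^2 (`eulerPart_zero_mul_eulerPart_two`). This relation is obtained from the pentagonal number
theorem by an involution on representations as sums of two squares. The quintic comes from
evaluating the product of E_1(ωq) over fifth roots of unity ω in two ways: factor by factor, and
through the dissection (`eulerE_norm`). -/

/-! ### Euler products as power series. -/

theorem continuous_of_continuous_coeff {R S : Type*} [Semiring R] [Semiring S]
    [TopologicalSpace R] [TopologicalSpace S] {f : R⟦X⟧ → S⟦X⟧}
    (h : ∀ d, Continuous (coeff d ∘ f)) : Continuous f :=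
  continuous_iff_continuousAt.mpr fun _ =>
    (WithPiTopology.tendsto_iff_coeff_tendsto _ _ _ _).mpr fun d => (h d).continuousAt

theorem eulerE_one : eulerE 1 = pentagonalSeries ℤ := by
  rw [eulerE, ← WithPiTopology.tprod_one_sub_X_pow]
  simp

theorem hasProd_eulerE {j : ℕ} (hj : 0 < j) :
    HasProd (fun n : ℕ => (1 - X ^ (j * (n + 1)) : ℤ⟦X⟧)) (eulerE j) :=
  (multipliable_eulerE hj).hasProd

theorem expand_eulerE {k j : ℕ} (hk : k ≠ 0) (hj : 0 < j) :
    expand k hk (eulerE j) = eulerE (k * j) := by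
  have hc : Continuous (expand k hk : ℤ⟦X⟧ →ₐ[ℤ] ℤ⟦X⟧) := by
    refine continuous_of_continuous_coeff fun d => ?_
    simp_rw [Function.comp_def, coeff_expand]
    split_ifs
    · exact WithPiTopology.continuous_coeff ℤ _
    · exact continuous_const
  have h := (hasProd_eulerE hj).map (expand k hk : ℤ⟦X⟧ →ₐ[ℤ] ℤ⟦X⟧) hc
  refine (h.tprod_eq.symm.trans ?_)
  rw [eulerE]
  congr 1
  ext1 n
  simp [expand_X, ← pow_mul, mul_assoc]

theorem eulerE_ne_zero {j : ℕ} (hj : 0 < j) : eulerE j ≠ 0 := fun h => by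
  simpa [h] using constantCoeff_eulerE hj

/-! ### Extraction of exponents modulo 5. -/

/-- The series `∑ a(5n + r) q^n` extracted from `∑ a(n) q^n`. -/
noncomputable def section5 (r : ℕ) : ℤ⟦X⟧ →+ ℤ⟦X⟧ where
  toFun f := mk fun n => coeff (5 * n + r) f
  map_add' f g := by ext; simp
  map_zero' := by ext; simp

theorem coeff_section5 (r n : ℕ) (f : ℤ⟦X⟧) :
    coeff n (section5 r f) = coeff (5 * n + r) f := by simp [section5]

/-- All exponents of `f` lie in the residue class `r` modulo 5. -/
def ResidueClass (r : ZMod 5) (f : ℤ⟦X⟧) : Prop :=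
  ∀ n : ℕ, (n : ZMod 5) ≠ r → coeff n f = 0

theorem ResidueClass.mul {r s : ZMod 5} {f g : ℤ⟦X⟧} (hf : ResidueClass r f)
    (hg : ResidueClass s g) : ResidueClass (r + s) (f * g) := by
  intro n hn
  rw [coeff_mul]
  refine Finset.sum_eq_zero fun p hp => ?_
  rw [Finset.HasAntidiagonal.mem_antidiagonal] at hp
  by_cases h1 : (p.1 : ZMod 5) = r
  · have h2 : (p.2 : ZMod 5) ≠ s := by
      rintro rfl
      exact hn (by rw [← hp, Nat.cast_add, h1])
    rw [hg _ h2, mul_zero]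
  · rw [hf _ h1, zero_mul]

theorem residueClass_one : ResidueClass 0 (1 : ℤ⟦X⟧) := by
  intro n hn
  rw [coeff_one, if_neg]
  rintro rfl
  simp at hn

theorem ResidueClass.pow {r : ZMod 5} {f : ℤ⟦X⟧} (hf : ResidueClass r f) (k : ℕ) :
    ResidueClass (k * r) (f ^ k) := by
  induction k with
  | zero => simpa using residueClass_one
  | succ k ih =>
    rw [pow_succ]
    convert ih.mul hf using 1
    push_cast; ring

theorem ResidueClass.section5_eq_zero {r : ZMod 5} (hr : r ≠ 0) {f : ℤ⟦X⟧}
    (hf : ResidueClass r f) : section5 0 f = 0 := by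
  ext n
  rw [coeff_section5, map_zero]
  apply hf
  have : (5 : ZMod 5) = 0 := rfl
  simpa [this] using hr.symm

/-- Series in q^5 are scalars for U: only exponents divisible by 5 of the second factor can
contribute. -/
theorem section5_expand_mul (g f : ℤ⟦X⟧) :
    section5 0 (expand 5 (by norm_num) g * f) = g * section5 0 f := by
  have key : ∀ n, coeff n (section5 0 (expand 5 (by norm_num) g * f))
      = coeff n (g * section5 0 f) := by
    intro n
    rw [coeff_section5, coeff_mul, coeff_mul]
    symm
    refine Finset.sum_of_injOn (fun p : ℕ × ℕ => (5 * p.1, 5 * p.2)) ?_ ?_ ?_ ?_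
    · rintro ⟨a, b⟩ _ ⟨a', b'⟩ _ h
      simp only [Prod.mk.injEq] at h
      ext <;> simp <;> omega
    · rintro ⟨a, b⟩ h
      simp only [Finset.mem_coe, Finset.HasAntidiagonal.mem_antidiagonal] at h ⊢
      omega
    · rintro ⟨a, b⟩ h h'
      rw [coeff_expand, if_neg, zero_mul]
      rintro ⟨a', ha'⟩
      apply h'
      simp only [Finset.HasAntidiagonal.mem_antidiagonal] at h
      refine ⟨(a', n - a'), ?_, ?_⟩
      · simp only [Finset.mem_coe, Finset.HasAntidiagonal.mem_antidiagonal]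
        omega
      · simp only [Prod.mk.injEq] at h ⊢
        omega
    · rintro ⟨a, b⟩ _
      simp [coeff_section5, coeff_expand_mul]
  exact PowerSeries.ext key

theorem section5_expand (g : ℤ⟦X⟧) : section5 0 (expand 5 (by norm_num) g) = g := by
  have h1 : section5 0 (1 : ℤ⟦X⟧) = 1 := by
    ext n; simp [coeff_section5, coeff_one]
  simpa [h1] using section5_expand_mul g 1

theorem section5_X_pow_mul (k : ℕ) {r s : ℕ} (f : ℤ⟦X⟧) (hr : r < 5) (h : 5 * k = r + s) :
    section5 0 (X ^ s * f) = X ^ k * section5 r f := by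
  ext n
  rw [coeff_section5, coeff_X_pow_mul', coeff_X_pow_mul']
  by_cases hn : k ≤ n
  · rw [if_pos (by omega), if_pos hn, coeff_section5]
    congr 2
    omega
  · rw [if_neg (by omega), if_neg hn]

/-! ### Coefficients of E_1 as character values, and sums of two squares. -/

/-- The even primitive quadratic character modulo 12. -/
def chi12 (a : ZMod 12) : ℤ :=
  if a = 1 ∨ a = 11 then 1 else if a = 5 ∨ a = 7 then -1 else 0

theorem chi12_neg (a : ZMod 12) : chi12 (-a) = chi12 a := by
  revert a; decide

theorem chi12_five_mul (a : ZMod 12) : chi12 (5 * a) = -chi12 a := by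
  revert a; decide

/-- Multiplication by `2 + i` of the conjugate Gaussian integers `u + iv` and `u - iv`. -/
theorem chi12_conj (u v : ZMod 12) :
    chi12 (2 * u + v) * chi12 (u - 2 * v) = -(chi12 (2 * u - v) * chi12 (u + 2 * v)) := by
  revert u v; decide

theorem sq_eq_one_of_chi12_ne_zero (a : ℤ) (h : chi12 a ≠ 0) : ∃ i : ℕ, a ^ 2 = 24 * i + 1 := by
  have h1 : ∀ b : ZMod 12, chi12 b ≠ 0 → b = 1 ∨ b = 11 ∨ b = 5 ∨ b = 7 := by decide
  have h2 : ∃ k : ℤ, a = 12 * k + 1 ∨ a = 12 * k + 11 ∨ a = 12 * k + 5 ∨ a = 12 * k + 7 := by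
    have h3 : ∀ r : ℤ, (a : ZMod 12) = (r : ZMod 12) → ∃ k, a = 12 * k + r := by
      intro r hr
      obtain ⟨k, hk⟩ := (ZMod.intCast_eq_intCast_iff_dvd_sub r a 12).mp hr.symm
      exact ⟨k, by push_cast at hk; linarith⟩
    rcases h1 _ h with h | h | h | h
    · obtain ⟨k, hk⟩ := h3 1 (by simpa using h); exact ⟨k, by tauto⟩
    · obtain ⟨k, hk⟩ := h3 11 (by simpa using h); exact ⟨k, by tauto⟩
    · obtain ⟨k, hk⟩ := h3 5 (by simpa using h); exact ⟨k, by tauto⟩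
    · obtain ⟨k, hk⟩ := h3 7 (by simpa using h); exact ⟨k, by tauto⟩
  have h4 : ∃ i : ℤ, a ^ 2 = 24 * i + 1 := by
    obtain ⟨k, rfl | rfl | rfl | rfl⟩ := h2
    · exact ⟨6 * k ^ 2 + k, by ring⟩
    · exact ⟨6 * k ^ 2 + 11 * k + 5, by ring⟩
    · exact ⟨6 * k ^ 2 + 5 * k + 1, by ring⟩
    · exact ⟨6 * k ^ 2 + 7 * k + 2, by ring⟩
  obtain ⟨i, hi⟩ := h4
  have : 0 ≤ i := by nlinarith [sq_nonneg a]
  lift i to ℕ using this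
  exact ⟨i, hi⟩

/-- This is the pentagonal number theorem after completing the square: 24·k(3k-1)/2 + 1 = (6k-1)^2,
and the sign (-1)^k is `chi12 (6k-1)`. Evenness of the character makes the choice of square root
irrelevant. -/
theorem coeff_eulerE_one_of_sq {x : ℤ} {n : ℕ} (h : x ^ 2 = 24 * n + 1) :
    coeff n (eulerE 1) = chi12 x := by
  wlog hx : x % 6 = 5 generalizing x
  · have h6 : x % 6 = 1 ∨ x % 6 = 5 := by
      have h1 : x ^ 2 % 6 = 1 := by omega
      rw [pow_two, Int.mul_emod] at h1
      have : 0 ≤ x % 6 := Int.emod_nonneg _ (by norm_num)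
      have : x % 6 < 6 := Int.emod_lt_of_pos _ (by norm_num)
      interval_cases x % 6 <;> simp_all
    rw [this (x := -x) (by linarith [neg_sq x]) (by omega), Int.cast_neg, chi12_neg]
  obtain ⟨k, rfl⟩ : ∃ k, x = 6 * k - 1 := ⟨(x + 1) / 6, by omega⟩
  have hk : pentagonal k = n := by
    have := two_mul_natCast_pentagonal k
    zify
    nlinarith
  rw [eulerE_one, ← hk, coeff_pentagonalSeries_pentagonal]
  obtain ⟨l, rfl | rfl⟩ := Int.even_or_odd' k
  · have h12 : ((6 * (2 * l) - 1 : ℤ) : ZMod 12) = 11 := by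
      have : (12 : ZMod 12) = 0 := rfl
      push_cast; linear_combination (l - 1) * this
    rw [h12, Int.negOnePow_even _ (even_two_mul l)]
    rfl
  · have h12 : ((6 * (2 * l + 1) - 1 : ℤ) : ZMod 12) = 5 := by
      have : (12 : ZMod 12) = 0 := rfl
      push_cast; linear_combination l * this
    rw [h12, Int.negOnePow_odd _ (odd_two_mul_add_one l)]
    rfl

theorem coeff_eulerE_one_eq_zero {n : ℕ} (h : ∀ x : ℤ, x ^ 2 ≠ 24 * n + 1) :
    coeff n (eulerE 1) = 0 := by
  rw [eulerE_one]
  refine coeff_pentagonalSeries_eq_zero _ ?_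
  rintro ⟨k, rfl⟩
  have := two_mul_natCast_pentagonal k
  exact h (6 * k - 1) (by linarith)

/-- The factor 2 counts the two roots x and -x. -/
theorem two_mul_coeff_eulerE_one {i : ℕ} {R : ℤ} (hR : 24 * (i : ℤ) + 1 ≤ R) :
    2 * coeff i (eulerE 1) =
      ∑ x ∈ Finset.Icc (-R) R, if x ^ 2 = 24 * (i : ℤ) + 1 then chi12 x else 0 := by
  rw [← Finset.sum_filter]
  by_cases h : ∃ x : ℤ, x ^ 2 = 24 * (i : ℤ) + 1
  · obtain ⟨x, hx⟩ := h
    have hf : (Finset.Icc (-R) R).filter (fun y : ℤ => y ^ 2 = 24 * (i : ℤ) + 1) = {x, -x} := by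
      ext y
      simp only [Finset.mem_filter, Finset.mem_Icc, Finset.mem_insert, Finset.mem_singleton]
      rw [← hx, sq_eq_sq_iff_eq_or_eq_neg]
      refine ⟨fun h => h.2, fun h => ⟨?_, h⟩⟩
      have : y ^ 2 ≤ R := by rcases h with rfl | rfl <;> [skip; rw [neg_sq]] <;> linarith
      constructor <;> nlinarith
    have hne : x ≠ -x := by
      intro h
      have : x = 0 := by linarith
      subst this
      omega
    rw [hf, Finset.sum_pair hne, Int.cast_neg, chi12_neg, coeff_eulerE_one_of_sq hx]
    ring
  · push Not at h
    rw [coeff_eulerE_one_eq_zero h, Finset.sum_eq_zero, mul_zero]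
    intro x hx
    exact absurd (Finset.mem_filter.mp hx).2 (h x)

theorem four_mul_coeff_sq {f : ℤ⟦X⟧} {ψ : ℤ → ℤ} {s : Finset ℤ} {n : ℕ}
    (hψ : ∀ x, ψ x ≠ 0 → ∃ i : ℕ, x ^ 2 = 24 * i + 1)
    (hf : ∀ i ≤ n, 2 * coeff i f = ∑ x ∈ s, if x ^ 2 = 24 * (i : ℤ) + 1 then ψ x else 0) :
    4 * coeff n (f ^ 2) =
      ∑ x ∈ s, ∑ y ∈ s, if x ^ 2 + y ^ 2 = 24 * (n : ℤ) + 2 then ψ x * ψ y else 0 := by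
  have h1 : 4 * coeff n (f ^ 2) = ∑ p ∈ Finset.HasAntidiagonal.antidiagonal n, ∑ x ∈ s, ∑ y ∈ s,
      (if x ^ 2 = 24 * (p.1 : ℤ) + 1 then ψ x else 0) *
        (if y ^ 2 = 24 * (p.2 : ℤ) + 1 then ψ y else 0) := by
    rw [pow_two, coeff_mul, Finset.mul_sum]
    refine Finset.sum_congr rfl fun p hp => ?_
    rw [Finset.HasAntidiagonal.mem_antidiagonal] at hp
    rw [← Finset.sum_mul_sum, ← hf _ (by omega), ← hf _ (by omega)]
    ring
  rw [h1, Finset.sum_comm]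
  refine Finset.sum_congr rfl fun x _ => ?_
  rw [Finset.sum_comm]
  refine Finset.sum_congr rfl fun y _ => ?_
  by_cases hx : ψ x = 0
  · simp [hx]
  by_cases hy : ψ y = 0
  · simp [hy]
  obtain ⟨i, hi⟩ := hψ x hx
  obtain ⟨j, hj⟩ := hψ y hy
  split_ifs with hn
  · rw [Finset.sum_eq_single (i, j)]
    · simp [hi, hj]
    · rintro ⟨a, b⟩ _ hab
      by_cases ha : a = i
      · have hb : b ≠ j := fun hb => hab (by rw [ha, hb])
        rw [if_neg (c := y ^ 2 = _) (by simp only; omega), mul_zero]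
      · rw [if_neg (c := x ^ 2 = _) (by simp only; omega), zero_mul]
    · intro h
      exact absurd (Finset.HasAntidiagonal.mem_antidiagonal.mpr (by simp only; omega)) h
  · refine Finset.sum_eq_zero fun p hp => ?_
    rw [Finset.HasAntidiagonal.mem_antidiagonal] at hp
    by_cases ha : x ^ 2 = 24 * (p.1 : ℤ) + 1
    · rw [if_neg (c := y ^ 2 = _) (by omega), mul_zero]
    · rw [if_neg ha, zero_mul]

/-- The divisibility condition says that 2+i divides x+iy in the Gaussian integers. Writing x+iy =
(2+i)(u+iv), conjugation of the cofactor preserves the norm and, by `chi12_conj`, reverses the sign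
of the summand. -/
theorem sum_chi12_mul_chi12_eq_zero (N R : ℤ) (hR : N ≤ R) :
    ∑ p ∈ (Finset.Icc (-R) R ×ˢ Finset.Icc (-R) R).filter
      (fun p : ℤ × ℤ => p.1 ^ 2 + p.2 ^ 2 = N ∧ 5 ∣ p.1 - 2 * p.2),
      chi12 p.1 * chi12 p.2 = 0 := by
  have key : ∀ x y : ℤ, 5 ∣ x - 2 * y → ∃ u v : ℤ, x = 2 * u - v ∧ y = u + 2 * v := by
    rintro x y ⟨k, hk⟩
    exact ⟨y + 2 * k, -k, by linarith, by ring⟩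
  have hg : ∀ u v : ℤ, (3 * (2 * u - v) + 4 * (u + 2 * v)) / 5 = 2 * u + v ∧
      (4 * (2 * u - v) - 3 * (u + 2 * v)) / 5 = u - 2 * v := fun u v => by omega
  refine Finset.sum_involution
    -- This is the map z ↦ (2+i)/(2-i) · conj z, with (2+i)/(2-i) = (3+4i)/5.
    (fun p _ => ((3 * p.1 + 4 * p.2) / 5, (4 * p.1 - 3 * p.2) / 5)) ?_ ?_ ?_ ?_
  · rintro ⟨x, y⟩ hp
    obtain ⟨u, v, rfl, rfl⟩ := key x y (Finset.mem_filter.mp hp).2.2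
    have := chi12_conj u v
    simp only [(hg u v).1, (hg u v).2]
    push_cast
    linarith
  · rintro ⟨x, y⟩ hp hne h
    obtain ⟨u, v, rfl, rfl⟩ := key x y (Finset.mem_filter.mp hp).2.2
    simp only [(hg u v).1, (hg u v).2, Prod.mk.injEq] at h
    have hv : v = 0 := by omega
    subst hv
    have := chi12_conj u 0
    apply hne
    push_cast
    simp only [mul_zero, add_zero, sub_zero] at this ⊢
    linarith
  · rintro ⟨x, y⟩ hp
    simp only [Finset.mem_filter] at hp ⊢
    obtain ⟨u, v, rfl, rfl⟩ := key x y hp.2.2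
    simp only [(hg u v).1, (hg u v).2, Finset.mem_product, Finset.mem_Icc]
    have h2 : (2 * u + v) ^ 2 + (u - 2 * v) ^ 2 = N := by rw [← hp.2.1]; ring
    refine ⟨⟨⟨?_, ?_⟩, ⟨?_, ?_⟩⟩, h2, ⟨v, by ring⟩⟩ <;> nlinarith
  · rintro ⟨x, y⟩ hp
    obtain ⟨u, v, rfl, rfl⟩ := key x y (Finset.mem_filter.mp hp).2.2
    simp only [(hg u v).1, (hg u v).2, Prod.mk.injEq]
    omega

/-! ### The 5-dissection of E_1. -/

/-- The part of `E_1` with exponents in the residue class of `r` modulo 5. -/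
noncomputable def eulerPart (r : ℕ) : ℤ⟦X⟧ :=
  mk fun n => if n % 5 = r then coeff n (eulerE 1) else 0

theorem residueClass_eulerPart {r : ℕ} (hr : r < 5) : ResidueClass r (eulerPart r) := by
  intro n hn
  rw [eulerPart, coeff_mk, if_neg]
  intro h
  apply hn
  rw [ZMod.natCast_eq_natCast_iff', h, Nat.mod_eq_of_lt hr]

theorem residueClass_X_mul_eulerE : ResidueClass 1 (X * eulerE 25) := by
  have h25 : eulerE 25 = expand 25 (by norm_num) (eulerE 1) :=
    (expand_eulerE (k := 25) (by norm_num) one_pos).symm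
  intro n hn
  rcases n with _ | n
  · simp
  rw [coeff_succ_X_mul, h25, coeff_expand, if_neg]
  rintro ⟨k, rfl⟩
  apply hn
  push_cast
  have : (25 : ZMod 5) = 0 := rfl
  rw [this, zero_mul, zero_add]

/-- If n ≡ 1 mod 5, then a root of x^2 = 24n+1 is x = 5y, which forces n = 25k+1 with y^2 = 24k+1;
the sign is `chi12 5 = -1`. -/
theorem eulerPart_one : eulerPart 1 = -(X * eulerE 25) := by
  have h25 : eulerE 25 = expand 25 (by norm_num) (eulerE 1) :=
    (expand_eulerE (k := 25) (by norm_num) one_pos).symm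
  ext n
  rw [eulerPart, coeff_mk, map_neg]
  split_ifs with hn
  · obtain ⟨m, rfl⟩ : ∃ m, n = m + 1 := ⟨n - 1, by omega⟩
    rw [coeff_succ_X_mul, h25, coeff_expand]
    by_cases h : ∃ x : ℤ, x ^ 2 = 24 * ((m + 1 : ℕ) : ℤ) + 1
    · obtain ⟨x, hx⟩ := h
      have h5 : (5 : ℤ) ∣ x := by
        refine Int.Prime.dvd_pow' (k := 2) (by norm_num) ?_
        push_cast
        omega
      obtain ⟨y, rfl⟩ := h5
      have hm : 25 ∣ m := by
        have : (5 * y) ^ 2 = 25 * y ^ 2 := by ring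
        omega
      obtain ⟨k, rfl⟩ := hm
      rw [if_pos (dvd_mul_right _ _), coeff_eulerE_one_of_sq hx, Nat.mul_div_cancel_left _ (by norm_num),
        coeff_eulerE_one_of_sq (x := y) (by push_cast at hx; linarith)]
      push_cast
      exact chi12_five_mul y
    · push Not at h
      rw [coeff_eulerE_one_eq_zero h]
      split_ifs with hd
      · obtain ⟨k, rfl⟩ := hd
        rw [Nat.mul_div_cancel_left _ (by norm_num), coeff_eulerE_one_eq_zero, neg_zero]
        intro y hy
        apply h (5 * y)
        push_cast
        linarith
      · simp
  · rw [residueClass_X_mul_eulerE n, neg_zero]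
    intro h
    apply hn
    have : ((n : ℕ) : ZMod 5) = ((1 : ℕ) : ZMod 5) := by simpa using h
    exact (ZMod.natCast_eq_natCast_iff' _ _ _).mp this

theorem emod_five_of_sq {x : ℤ} {n : ℕ} (h : x ^ 2 = 24 * n + 1) :
    (n % 5 = 0 ∨ n % 5 = 1 ∨ n % 5 = 2) ∧ (5 ∣ x ↔ n % 5 = 1) := by
  have h1 : x ^ 2 % 5 = (x % 5) * (x % 5) % 5 := by rw [pow_two, Int.mul_emod]
  have : 0 ≤ x % 5 := Int.emod_nonneg _ (by norm_num)
  have : x % 5 < 5 := Int.emod_lt_of_pos _ (by norm_num)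
  have : x % 5 = 0 ∨ x % 5 = 1 ∨ x % 5 = 2 ∨ x % 5 = 3 ∨ x % 5 = 4 := by omega
  rcases this with h2 | h2 | h2 | h2 | h2 <;> rw [h2] at h1 <;> norm_num at h1 <;> omega

theorem eulerE_one_dissection : eulerE 1 = eulerPart 0 - X * eulerE 25 + eulerPart 2 := by
  have : eulerE 1 = eulerPart 0 + eulerPart 1 + eulerPart 2 := by
    ext n
    simp only [map_add, eulerPart, coeff_mk]
    by_cases h : ∃ x : ℤ, x ^ 2 = 24 * (n : ℤ) + 1
    · obtain ⟨x, hx⟩ := h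
      rcases (emod_five_of_sq hx).1 with h | h | h <;> simp [h]
    · push Not at h
      simp [coeff_eulerE_one_eq_zero h]
  rw [this, eulerPart_one]
  ring

/-- Here 24n+2 is divisible by 5, so x^2+y^2 = 24n+2 forces x ≡ 2y or x ≡ -2y mod 5. The sums over
these two conditions vanish separately. Their total counts twice the pairs with both entries
divisible by 5, and the second summand is exactly that excess. -/
theorem coeff_eulerE_one_sq_add {n : ℕ} (hn : n % 5 = 2) :
    coeff n (eulerE 1 ^ 2) + coeff n (eulerPart 1 ^ 2) = 0 := by
  set R : ℤ := 24 * n + 2 with hR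
  set I := Finset.Icc (-R) R
  have h1 := four_mul_coeff_sq (f := eulerE 1) (ψ := fun x => chi12 x) (s := I) (n := n)
    sq_eq_one_of_chi12_ne_zero fun i hi => two_mul_coeff_eulerE_one (by omega)
  have h2 := four_mul_coeff_sq (f := eulerPart 1) (ψ := fun x => if 5 ∣ x then chi12 x else 0)
    (s := I) (n := n) (fun x hx => sq_eq_one_of_chi12_ne_zero x (by aesop)) (by
      intro i hi
      by_cases h5 : i % 5 = 1
      · rw [eulerPart, coeff_mk, if_pos h5, two_mul_coeff_eulerE_one (R := R) (by omega)]
        refine Finset.sum_congr rfl fun x _ => ?_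
        split_ifs with hx hd
        · rfl
        · exact absurd ((emod_five_of_sq hx).2.mpr h5) hd
        · rfl
      · rw [eulerPart, coeff_mk, if_neg h5, Finset.sum_eq_zero, mul_zero]
        intro x _
        split_ifs with hx hd
        · exact absurd ((emod_five_of_sq hx).2.mp hd) h5
        · rfl
        · rfl)
  have h3 := sum_chi12_mul_chi12_eq_zero R R le_rfl
  have h4 : ∑ p ∈ (I ×ˢ I).filter
      (fun p : ℤ × ℤ => p.1 ^ 2 + p.2 ^ 2 = R ∧ 5 ∣ p.1 + 2 * p.2),
      chi12 p.1 * chi12 p.2 = 0 := by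
    rw [← h3]
    refine Finset.sum_nbij' (fun p => (p.1, -p.2)) (fun p => (p.1, -p.2)) ?_ ?_ ?_ ?_ ?_
    · rintro ⟨x, y⟩ hp
      simp only [I, Finset.mem_filter, Finset.mem_product, Finset.mem_Icc, neg_sq] at hp ⊢
      refine ⟨by omega, hp.2.1, by omega⟩
    · rintro ⟨x, y⟩ hp
      simp only [I, Finset.mem_filter, Finset.mem_product, Finset.mem_Icc, neg_sq] at hp ⊢
      refine ⟨by omega, hp.2.1, by omega⟩
    · simp
    · simp
    · rintro ⟨x, y⟩ _
      simp [chi12_neg]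
  have h5 : 4 * coeff n (eulerE 1 ^ 2) + 4 * coeff n (eulerPart 1 ^ 2) = 0 := by
    rw [← hR] at h1 h2
    rw [h1, h2]
    refine Eq.trans ?_ ((congrArg₂ (· + ·) h3 h4).trans (zero_add 0))
    rw [← Finset.sum_product', ← Finset.sum_product', Finset.sum_filter,
      Finset.sum_filter, ← Finset.sum_add_distrib, ← Finset.sum_add_distrib]
    refine Finset.sum_congr rfl ?_
    rintro ⟨x, y⟩ _
    simp only
    by_cases hxy : x ^ 2 + y ^ 2 = R
    · have hx : x ^ 2 % 5 = (x % 5) * (x % 5) % 5 := by rw [pow_two, Int.mul_emod]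
      have hy : y ^ 2 % 5 = (y % 5) * (y % 5) % 5 := by rw [pow_two, Int.mul_emod]
      have hx' : x % 5 = 0 ∨ x % 5 = 1 ∨ x % 5 = 2 ∨ x % 5 = 3 ∨ x % 5 = 4 := by omega
      have hy' : y % 5 = 0 ∨ y % 5 = 1 ∨ y % 5 = 2 ∨ y % 5 = 3 ∨ y % 5 = 4 := by omega
      have hR5 : R % 5 = 0 := by omega
      have hcase : (5 ∣ x ∧ 5 ∣ y ∧ 5 ∣ x - 2 * y ∧ 5 ∣ x + 2 * y) ∨
          (¬ 5 ∣ x ∧ 5 ∣ x - 2 * y ∧ ¬ 5 ∣ x + 2 * y) ∨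
          (¬ 5 ∣ x ∧ ¬ 5 ∣ x - 2 * y ∧ 5 ∣ x + 2 * y) := by
        rcases hx' with h | h | h | h | h <;> rcases hy' with h' | h' | h' | h' | h' <;>
          rw [h] at hx <;> rw [h'] at hy <;> norm_num at hx hy <;> omega
      rcases hcase with ⟨a, b, c, d⟩ | ⟨a, c, d⟩ | ⟨a, c, d⟩ <;> simp [*]
    · simp [hxy]
  linarith

/-- In residue class 2 the square of E_1 = a + b' + c, with b' = `eulerPart 1`, is 2ac + b'^2, so
`coeff_eulerE_one_sq_add` reads 2(ac + b'^2) = 0. -/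
theorem eulerPart_zero_mul_eulerPart_two :
    eulerPart 0 * eulerPart 2 = -(X * eulerE 25) ^ 2 := by
  have r0 := residueClass_eulerPart (r := 0) (by norm_num)
  have r1 := residueClass_eulerPart (r := 1) (by norm_num)
  have r2 := residueClass_eulerPart (r := 2) (by norm_num)
  have hE : eulerE 1 = eulerPart 0 + eulerPart 1 + eulerPart 2 := by
    rw [eulerE_one_dissection, eulerPart_one]; ring
  have hsq : eulerE 1 ^ 2 = eulerPart 0 * eulerPart 0 + eulerPart 1 ^ 2 + eulerPart 2 * eulerPart 2
      + (eulerPart 0 * eulerPart 1 + eulerPart 0 * eulerPart 1)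
      + (eulerPart 1 * eulerPart 2 + eulerPart 1 * eulerPart 2)
      + (eulerPart 0 * eulerPart 2 + eulerPart 0 * eulerPart 2) := by
    rw [hE]; ring
  have h : eulerPart 0 * eulerPart 2 + eulerPart 1 ^ 2 = 0 := by
    ext n
    rw [map_zero]
    by_cases hn : n % 5 = 2
    · have h1 := coeff_eulerE_one_sq_add hn
      have hn' : (n : ZMod 5) = 2 :=
        (ZMod.natCast_eq_natCast_iff' n 2 5).mpr hn
      rw [hsq] at h1
      simp only [map_add] at h1
      rw [(r0.mul r0) n (by rw [hn']; decide), (r2.mul r2) n (by rw [hn']; decide),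
        (r0.mul r1) n (by rw [hn']; decide), (r1.mul r2) n (by rw [hn']; decide)] at h1
      rw [map_add]
      linarith
    · have hn' : (n : ZMod 5) ≠ ((2 : ℕ) : ZMod 5) := fun h =>
        hn ((ZMod.natCast_eq_natCast_iff' n 2 5).mp h)
      rw [map_add, (r0.mul r2) n (by simpa using hn'), pow_two,
        (r1.mul r1) n (by convert hn' using 1; rfl), add_zero]
  rw [eulerPart_one] at h
  linear_combination h

/-! ### The norm of E_1 over fifth roots of unity. -/

section FifthRoots

variable {R : Type*} [CommRing R] {η : R}

theorem fifth_root_periods_add (h : 1 + η + η ^ 2 + η ^ 3 + η ^ 4 = 0) :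
    (η + η ^ 4) + (η ^ 2 + η ^ 3) = -1 := by
  linear_combination h

theorem fifth_root_pow_five (h : 1 + η + η ^ 2 + η ^ 3 + η ^ 4 = 0) : η ^ 5 = 1 := by
  linear_combination (η - 1) * h

theorem fifth_root_periods_mul (h : 1 + η + η ^ 2 + η ^ 3 + η ^ 4 = 0) :
    (η + η ^ 4) * (η ^ 2 + η ^ 3) = -1 := by
  linear_combination h + (η + η ^ 2) * fifth_root_pow_five h

theorem prod_fifth_roots_one_sub (h : 1 + η + η ^ 2 + η ^ 3 + η ^ 4 = 0) (y : R) :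
    ∏ k ∈ Finset.range 5, (1 - η ^ k * y) = 1 - y ^ 5 := by
  have h5 := fifth_root_pow_five h
  have h1 : (1 - η * y) * (1 - η ^ 4 * y) = 1 - (η + η ^ 4) * y + y ^ 2 := by
    linear_combination y ^ 2 * h5
  have h2 : (1 - η ^ 2 * y) * (1 - η ^ 3 * y) = 1 - (η ^ 2 + η ^ 3) * y + y ^ 2 := by
    linear_combination y ^ 2 * h5
  simp only [Finset.prod_range_succ, Finset.prod_range_zero, one_mul, pow_zero, pow_one]
  calc _ = (1 - y) * (((1 - η * y) * (1 - η ^ 4 * y)) * ((1 - η ^ 2 * y) * (1 - η ^ 3 * y))) := by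
        ring
    _ = _ := by
      rw [h1, h2]
      linear_combination (1 - y) * (y ^ 2 * fifth_root_periods_mul h
        - y * (1 + y ^ 2) * fifth_root_periods_add h)

theorem prod_fifth_roots_trinomial (h : 1 + η + η ^ 2 + η ^ 3 + η ^ 4 = 0) {a b c : R}
    (hac : a * c = -b ^ 2) :
    ∏ k ∈ Finset.range 5, (a - η ^ k * b + η ^ (2 * k) * c) = a ^ 5 - 11 * b ^ 5 + c ^ 5 := by
  have h5 := fifth_root_pow_five h
  have h1 : (a - η * b + η ^ 2 * c) * (a - η ^ 4 * b + η ^ 8 * c) =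
      a ^ 2 + b ^ 2 + c ^ 2 - (η + η ^ 4) * (a * b + b * c) + (η ^ 2 + η ^ 3) * (a * c) := by
    linear_combination (b ^ 2 + η ^ 3 * a * c - η ^ 4 * b * c - η * b * c + (η ^ 5 + 1) * c ^ 2) * h5
  have h2 : (a - η ^ 2 * b + η ^ 4 * c) * (a - η ^ 3 * b + η ^ 6 * c) =
      a ^ 2 + b ^ 2 + c ^ 2 - (η ^ 2 + η ^ 3) * (a * b + b * c) + (η + η ^ 4) * (a * c) := by
    linear_combination (b ^ 2 + η * a * c - η ^ 3 * b * c - η ^ 2 * b * c + (η ^ 5 + 1) * c ^ 2) * h5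
  simp only [Finset.prod_range_succ, Finset.prod_range_zero, one_mul, pow_zero, pow_one, mul_zero,
    mul_one, Nat.reduceMul]
  calc _ = (a - b + c) * (((a - η * b + η ^ 2 * c) * (a - η ^ 4 * b + η ^ 8 * c)) *
        ((a - η ^ 2 * b + η ^ 4 * c) * (a - η ^ 3 * b + η ^ 6 * c))) := by
        ring
    _ = (a - b + c) * ((a ^ 2 + b ^ 2 + c ^ 2) ^ 2
        - (a ^ 2 + b ^ 2 + c ^ 2) * (-(a * b + b * c) + a * c) - (a * b + b * c) ^ 2 - (a * c) ^ 2
        - 3 * (a * b + b * c) * (a * c)) := by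
      rw [h1, h2]
      have hs := fifth_root_periods_add h
      have hm := fifth_root_periods_mul h
      generalize η + η ^ 4 = g at hs hm ⊢
      generalize η ^ 2 + η ^ 3 = g' at hs hm ⊢
      obtain rfl : g' = -1 - g := by linear_combination hs
      linear_combination (a - b + c) * ((a * b + b * c) ^ 2 + (a * c) ^ 2
        + 2 * (a * b + b * c) * (a * c)) * hm
    _ = _ := by
      -- The product is a^5 - b^5 + c^5 + 5ab^3c - 5a^2bc^2. Under ac = -b^2 each mixed term becomes
      -- -5b^5, whence the 11.
      linear_combination (-5 * a * b * c + 10 * b ^ 3) * hac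

end FifthRoots

/-- The ring homomorphism `ℤ⟦X⟧ → ℂ⟦X⟧` with `X ↦ a X`. -/
noncomputable def complexRescale (a : ℂ) : ℤ⟦X⟧ →+* ℂ⟦X⟧ :=
  (rescale a).comp (map (Int.castRingHom ℂ))

theorem coeff_complexRescale (a : ℂ) (n : ℕ) (f : ℤ⟦X⟧) :
    coeff n (complexRescale a f) = a ^ n * (coeff n f : ℤ) := by
  simp [complexRescale, coeff_rescale]

theorem continuous_complexRescale (a : ℂ) : Continuous (complexRescale a) := by
  refine continuous_of_continuous_coeff fun d => ?_
  simp_rw [Function.comp_def, coeff_complexRescale]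
  exact continuous_const.mul
    (continuous_of_discreteTopology.comp (WithPiTopology.continuous_coeff ℤ d))

theorem complexRescale_injective : Function.Injective (complexRescale 1) := by
  intro f g h
  ext n
  simpa [coeff_complexRescale] using congrArg (coeff n) h

theorem complexRescale_X_pow (a : ℂ) (n : ℕ) :
    complexRescale a (X ^ n) = C a ^ n * complexRescale 1 (X ^ n) := by
  simp [complexRescale, rescale_X, mul_pow]

theorem ResidueClass.complexRescale {r : ℕ} {f : ℤ⟦X⟧} (hf : ResidueClass r f) {a : ℂ}
    (ha : a ^ 5 = 1) : complexRescale a f = C a ^ r * complexRescale 1 f := by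
  ext n
  rw [← map_pow, coeff_C_mul, coeff_complexRescale, coeff_complexRescale, one_pow, one_mul]
  by_cases hn : (n : ZMod 5) = r
  · rw [pow_eq_pow_mod n ha, (ZMod.natCast_eq_natCast_iff' _ _ _).mp hn, ← pow_eq_pow_mod r ha]
  · simp [hf n hn]

/-- Padding with trivial factors indexes E_5 and E_25 by all n, so that `eulerE_norm` can be checked
factor by factor. -/
theorem hasProd_ite_dvd {f : ℕ → ℤ⟦X⟧} {a : ℤ⟦X⟧}
    (h : HasProd (fun n : ℕ => f (5 * (n + 1))) a) :
    HasProd (fun n : ℕ => if 5 ∣ n + 1 then f (n + 1) else 1) a := by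
  have hinj : Function.Injective fun n : ℕ => 5 * n + 4 := fun x y hxy => by
    simp only at hxy; omega
  rw [← hinj.hasProd_iff]
  · convert h using 2 with n
    rw [Function.comp_apply, if_pos (by omega)]
    congr 1
  · intro n hn
    rw [if_neg]
    intro hd
    exact hn ⟨(n + 1) / 5 - 1, by simp only; omega⟩

/-- In the product of E_1(ω^k q) over k, the n-th factor is 1 - q^{5n} if 5 ∤ n and (1 - q^n)^5 if 5
∣ n. Multiplying by E_25 supplies the missing 1 - q^{5n}, which completes E_5 · E_5^5. -/
theorem eulerE_norm :
    eulerE 25 * (eulerPart 0 ^ 5 - 11 * (X * eulerE 25) ^ 5 + eulerPart 2 ^ 5) =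
      eulerE 5 ^ 6 := by
  have hω := Complex.isPrimitiveRoot_exp 5 (by norm_num)
  set ω := Complex.exp (2 * Real.pi * Complex.I / (5 : ℕ))
  have hsum : ∀ m : ℕ, ¬ 5 ∣ m →
      1 + ω ^ m + (ω ^ m) ^ 2 + (ω ^ m) ^ 3 + (ω ^ m) ^ 4 = 0 := by
    intro m hm
    have hm' : m.Coprime 5 := ((Nat.Prime.coprime_iff_not_dvd (by norm_num)).mpr hm).symm
    have := (hω.pow_of_coprime m hm').geom_sum_eq_zero (by norm_num)
    simpa [Finset.sum_range_succ] using this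
  have hC : ∀ m : ℕ, ¬ 5 ∣ m →
      1 + C ω ^ m + (C ω ^ m) ^ 2 + (C ω ^ m) ^ 3 + (C ω ^ m) ^ 4 = (0 : ℂ⟦X⟧) := by
    intro m hm
    have := congrArg (C (R := ℂ)) (hsum m hm)
    simpa using this
  have hpow : ∀ k, (ω ^ k) ^ 5 = 1 := fun k => by
    rw [← pow_mul, mul_comm, pow_mul, hω.pow_eq_one, one_pow]
  have hnorm : ∏ k ∈ Finset.range 5, complexRescale (ω ^ k) (eulerE 1) =
      complexRescale 1 (eulerPart 0 ^ 5 - 11 * (X * eulerE 25) ^ 5 + eulerPart 2 ^ 5) := by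
    have h := prod_fifth_roots_trinomial (by simpa using hC 1 (by norm_num))
      (by simpa using congrArg (complexRescale 1) eulerPart_zero_mul_eulerPart_two)
    simp only [map_add, map_sub, map_mul, map_pow, map_ofNat] at h ⊢
    rw [← h]
    refine Finset.prod_congr rfl fun k _ => ?_
    have hb : ResidueClass (1 : ℕ) (X * eulerE 25) := by
      simpa using residueClass_X_mul_eulerE
    rw [eulerE_one_dissection, map_add, map_sub,
      (residueClass_eulerPart (r := 0) (by norm_num)).complexRescale (hpow k),
      (residueClass_eulerPart (r := 2) (by norm_num)).complexRescale (hpow k),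
      hb.complexRescale (hpow k)]
    simp only [map_mul, map_pow]
    ring
  have hterm : ∀ m k, complexRescale (ω ^ k) (1 - X ^ m) =
      1 - (C ω ^ m) ^ k * complexRescale 1 (X ^ m) := by
    intro m k
    rw [map_sub, map_one, complexRescale_X_pow, map_pow, ← pow_mul, ← pow_mul, mul_comm m k]
  have h1 : HasProd (fun n : ℕ => ∏ k ∈ Finset.range 5,
      complexRescale (ω ^ k) (1 - X ^ (1 * (n + 1))))
      (∏ k ∈ Finset.range 5, complexRescale (ω ^ k) (eulerE 1)) :=
    hasProd_prod fun k _ => (hasProd_eulerE one_pos).map _ (continuous_complexRescale _)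
  have h5 := (hasProd_eulerE (j := 5) (by norm_num)).map _ (continuous_complexRescale 1)
  have h5' := (hasProd_ite_dvd (f := fun n => 1 - X ^ n)
    (hasProd_eulerE (j := 5) (by norm_num))).map _ (continuous_complexRescale 1)
  have h25 := (hasProd_ite_dvd (f := fun n => 1 - X ^ (5 * n)) (a := eulerE 25) (by
    convert hasProd_eulerE (j := 25) (by norm_num) using 4 with n
    ring)).map _ (continuous_complexRescale 1)
  have h5p := hasProd_prod (s := Finset.range 5) fun k _ => h5'
  apply complexRescale_injective
  rw [map_mul, ← hnorm]
  refine ((h25.mul h1).unique ?_)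
  convert h5.mul h5p using 1
  · ext1 n
    simp only [Function.comp_apply, one_mul, Finset.prod_const, Finset.card_range]
    simp_rw [hterm]
    split_ifs with hn
    · have hone : C ω ^ (n + 1) = (1 : ℂ⟦X⟧) := by
        obtain ⟨d, hd⟩ := hn
        rw [hd, pow_mul, ← map_pow, hω.pow_eq_one, map_one, one_pow]
      simp [hone]
    · rw [prod_fifth_roots_one_sub (hC _ hn), map_one, one_pow, mul_one, one_mul, map_sub, map_one,
        ← map_pow, ← pow_mul, mul_comm 5]
  · simp only [map_pow, Finset.prod_const, Finset.card_range]
    ring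

/-! ### The modular equation and U of the powers of ζ. -/

theorem section5_intCast_mul (r : ℕ) (a : ℤ) (f : ℤ⟦X⟧) :
    section5 r (a * f) = a * section5 r f := by
  rw [← zsmul_eq_mul, map_zsmul, zsmul_eq_mul]

theorem section5_eulerPart_zero_pow_mul (i j : ℕ) (hj : (j : ZMod 5) ≠ 0) :
    section5 0 (eulerPart 0 ^ i * (X * eulerE 25) ^ j) = 0 := by
  refine (((residueClass_eulerPart (r := 0) (by norm_num)).pow i).mul
    (residueClass_X_mul_eulerE.pow j)).section5_eq_zero ?_
  simpa using hj

theorem section5_eulerPart_two_pow_mul (i j : ℕ) (hj : ((2 * i + j : ℕ) : ZMod 5) ≠ 0) :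
    section5 0 (eulerPart 2 ^ i * (X * eulerE 25) ^ j) = 0 := by
  refine (((residueClass_eulerPart (r := 2) (by norm_num)).pow i).mul
    (residueClass_X_mul_eulerE.pow j)).section5_eq_zero ?_
  push_cast at hj ⊢
  rwa [mul_one, mul_comm (i : ZMod 5)]

theorem expand_five_X_mul_eulerE :
    expand 5 (by norm_num) (X * eulerE 5 ^ 5) = (X * eulerE 25) ^ 5 := by
  rw [map_mul, map_pow, expand_X, expand_eulerE _ (by norm_num), mul_pow]

/-- The constant terms of the powers of `E_1 / (q E_25)`, after clearing denominators. -/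
theorem section5_X_mul_eulerE_pow_mul (k : ℕ) (hk : k ≤ 4) :
    section5 0 ((X * eulerE 25) * (X * eulerE 25) ^ k * eulerE 1 ^ (4 - k)) =
      (([-5, 5, -1, -1, 1].getD k 0 : ℤ) : ℤ⟦X⟧) * (X * eulerE 5 ^ 5) := by
  have h5 : section5 0 ((X * eulerE 25) ^ 5) = X * eulerE 5 ^ 5 := by
    rw [← expand_five_X_mul_eulerE, section5_expand]
  have hA : ∀ i j : ℕ, (j : ZMod 5) ≠ 0 → _ := section5_eulerPart_zero_pow_mul
  have hC : ∀ i j : ℕ, ((2 * i + j : ℕ) : ZMod 5) ≠ 0 → _ := section5_eulerPart_two_pow_mul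
  have hac := eulerPart_zero_mul_eulerPart_two
  rw [eulerE_one_dissection]
  set a := eulerPart 0
  set c := eulerPart 2
  set b := X * eulerE 25
  interval_cases k
  -- The relation ac = -b^2 removes every monomial containing both a and c. Of what remains, only
  -- b^5 has exponents divisible by 5.
  · have : b * b ^ 0 * (a - b + c) ^ (4 - 0) = ((-5 : ℤ) : ℤ⟦X⟧) * b ^ 5
        + a ^ 4 * b ^ 1 + ((-4 : ℤ) : ℤ⟦X⟧) * (a ^ 3 * b ^ 2) + ((2 : ℤ) : ℤ⟦X⟧) * (a ^ 2 * b ^ 3)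
        + ((8 : ℤ) : ℤ⟦X⟧) * (a ^ 1 * b ^ 4)
        + c ^ 4 * b ^ 1 + ((-4 : ℤ) : ℤ⟦X⟧) * (c ^ 3 * b ^ 2) + ((2 : ℤ) : ℤ⟦X⟧) * (c ^ 2 * b ^ 3)
        + ((8 : ℤ) : ℤ⟦X⟧) * (c ^ 1 * b ^ 4) := by
      push_cast
      linear_combination (4 * a ^ 2 * b + 6 * a * b * c + 4 * b * c ^ 2 - 12 * a * b ^ 2
        - 12 * b ^ 2 * c + 6 * b ^ 3) * hac
    rw [this]
    simp only [map_add, section5_intCast_mul, h5]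
    rw [hA, hA, hA, hA, hC, hC, hC, hC] <;> first | decide | simp
  · have : b * b ^ 1 * (a - b + c) ^ (4 - 1) = ((5 : ℤ) : ℤ⟦X⟧) * b ^ 5
        + a ^ 3 * b ^ 2 + ((-3 : ℤ) : ℤ⟦X⟧) * (a ^ 2 * b ^ 3)
        + c ^ 3 * b ^ 2 + ((-3 : ℤ) : ℤ⟦X⟧) * (c ^ 2 * b ^ 3) := by
      push_cast
      linear_combination (3 * a * b ^ 2 + 3 * b ^ 2 * c - 6 * b ^ 3) * hac
    rw [this]
    simp only [map_add, section5_intCast_mul, h5]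
    rw [hA, hA, hC, hC] <;> first | decide | simp
  · have : b * b ^ 2 * (a - b + c) ^ (4 - 2) = ((-1 : ℤ) : ℤ⟦X⟧) * b ^ 5
        + a ^ 2 * b ^ 3 + ((-2 : ℤ) : ℤ⟦X⟧) * (a ^ 1 * b ^ 4)
        + c ^ 2 * b ^ 3 + ((-2 : ℤ) : ℤ⟦X⟧) * (c ^ 1 * b ^ 4) := by
      push_cast
      linear_combination 2 * b ^ 3 * hac
    rw [this]
    simp only [map_add, section5_intCast_mul, h5]
    rw [hA, hA, hC, hC] <;> first | decide | simp
  · have : b * b ^ 3 * (a - b + c) ^ (4 - 3) = ((-1 : ℤ) : ℤ⟦X⟧) * b ^ 5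
        + a ^ 1 * b ^ 4 + c ^ 1 * b ^ 4 := by
      push_cast
      ring
    rw [this]
    simp only [map_add, section5_intCast_mul, h5]
    rw [hA, hC] <;> first | decide | simp
  · have : b * b ^ 4 * (a - b + c) ^ (4 - 4) = b ^ 5 := by ring
    rw [this, h5]
    simp

/-- The series `q E_25 / E_1`. -/
noncomputable def eulerQuot : ℤ⟦X⟧ := X * eulerE 25 * eulerEInv 1

/-- The series `q E_5^6 / E_1^6`. -/
noncomputable def eulerQuotSix : ℤ⟦X⟧ := X * eulerE 5 ^ 6 * eulerEInv 1 ^ 6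

theorem eulerE_mul_eulerQuot : eulerE 1 * eulerQuot = X * eulerE 25 := by
  rw [eulerQuot]
  linear_combination X * eulerE 25 * eulerE_mul_eulerEInv one_pos

theorem expand_eulerEInv :
    eulerE 5 * expand 5 (by norm_num) (eulerEInv 1) = 1 := by
  have h := congrArg (expand 5 (by norm_num)) (eulerE_mul_eulerEInv one_pos)
  rwa [map_mul, map_one, expand_eulerE _ one_pos] at h

/-- The modular equation of degree five. -/
theorem eulerQuot_pow_five :
    eulerQuot ^ 5 = expand 5 (by norm_num) eulerQuotSix *
      (25 * eulerQuot ^ 4 + 25 * eulerQuot ^ 3 + 15 * eulerQuot ^ 2 + 5 * eulerQuot + 1) := by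
  have ht : expand 5 (by norm_num) eulerQuotSix *
      (eulerPart 0 ^ 5 - 11 * (X * eulerE 25) ^ 5 + eulerPart 2 ^ 5) = (X * eulerE 25) ^ 5 := by
    have h1 : (eulerE 5 * expand 5 (by norm_num) (eulerEInv 1)) ^ 6 = 1 := by
      rw [expand_eulerEInv, one_pow]
    rw [eulerQuotSix, map_mul, map_mul, map_pow, map_pow, expand_X, expand_eulerE _ (by norm_num)]
    norm_num only
    linear_combination X ^ 5 * eulerE 25 ^ 5 * h1 + X ^ 5 * eulerE 25 ^ 5 *
      expand 5 (by norm_num) (eulerEInv 1) ^ 6 * eulerE_norm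
  -- The norm is rewritten as a quintic form in E_1 = a - b + c and b; dividing by E_1^5 turns it
  -- into the polynomial in ζ.
  have hD : eulerPart 0 ^ 5 - 11 * (X * eulerE 25) ^ 5 + eulerPart 2 ^ 5 =
      eulerE 1 ^ 5 + 5 * eulerE 1 ^ 4 * (X * eulerE 25) + 15 * eulerE 1 ^ 3 * (X * eulerE 25) ^ 2
      + 25 * eulerE 1 ^ 2 * (X * eulerE 25) ^ 3 + 25 * eulerE 1 * (X * eulerE 25) ^ 4 := by
    have hac := eulerPart_zero_mul_eulerPart_two
    rw [eulerE_one_dissection]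
    set a := eulerPart 0
    set c := eulerPart 2
    set b := X * eulerE 25
    linear_combination -(5 * a ^ 3 + 10 * a ^ 2 * c + 10 * a * c ^ 2 + 5 * c ^ 3 + 5 * a * b ^ 2
      + 5 * b ^ 2 * c) * hac
  rw [hD, ← eulerE_mul_eulerQuot] at ht
  apply mul_left_cancel₀ (pow_ne_zero 5 (eulerE_ne_zero one_pos))
  linear_combination -ht

theorem m_zero_right (i : ℕ) : m i 0 = 0 := by
  rcases i with _ | _ | _ | _ | _ | _ | i <;> simp [m]

theorem sum_m_succ (x : ℤ⟦X⟧) (i N : ℕ) :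
    ∑ j ∈ Finset.range (N + 1), (m (i + 6) j : ℤ⟦X⟧) * x ^ j =
      x * (25 * ∑ j ∈ Finset.range N, (m (i + 5) j : ℤ⟦X⟧) * x ^ j
        + 25 * ∑ j ∈ Finset.range N, (m (i + 4) j : ℤ⟦X⟧) * x ^ j
        + 15 * ∑ j ∈ Finset.range N, (m (i + 3) j : ℤ⟦X⟧) * x ^ j
        + 5 * ∑ j ∈ Finset.range N, (m (i + 2) j : ℤ⟦X⟧) * x ^ j
        + ∑ j ∈ Finset.range N, (m (i + 1) j : ℤ⟦X⟧) * x ^ j) := by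
  rw [Finset.sum_range_succ', m_zero_right]
  simp only [Finset.mul_sum, ← Finset.sum_add_distrib, Int.cast_zero, zero_mul, add_zero]
  refine Finset.sum_congr rfl fun j _ => ?_
  rcases j with _ | j
  · simp only [m_zero_right]
    simp [m]
  · rw [m]
    push_cast
    ring

/-- The powers of `q E_25 / E_1`, restricted to exponents divisible by 5. -/
theorem section5_eulerQuot_pow (i : ℕ) (hi : 1 ≤ i) : ∀ N, i < N →
    section5 0 (eulerQuot ^ i) =
      ∑ j ∈ Finset.range N, (m i j : ℤ⟦X⟧) * eulerQuotSix ^ j := by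
  -- `w n` stands for b^5 ζ^(n-4): the factor b^5, a series in q^5, clears denominators, so the
  -- recurrence can start from the exponents -4, …, 0.
  set w : ℕ → ℤ⟦X⟧ := fun n => X * eulerE 25 * eulerE 1 ^ 4 * eulerQuot ^ n with hw
  have hrec : ∀ n, section5 0 (w (n + 5)) = eulerQuotSix * (25 * section5 0 (w (n + 4))
      + 25 * section5 0 (w (n + 3)) + 15 * section5 0 (w (n + 2)) + 5 * section5 0 (w (n + 1))
      + section5 0 (w n)) := by
    intro n
    have : w (n + 5) = expand 5 (by norm_num) eulerQuotSix * (((25 : ℤ) : ℤ⟦X⟧) * w (n + 4)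
        + ((25 : ℤ) : ℤ⟦X⟧) * w (n + 3) + ((15 : ℤ) : ℤ⟦X⟧) * w (n + 2)
        + ((5 : ℤ) : ℤ⟦X⟧) * w (n + 1) + w n) := by
      simp only [hw]
      push_cast
      linear_combination X * eulerE 25 * eulerE 1 ^ 4 * eulerQuot ^ n * eulerQuot_pow_five
    rw [this, section5_expand_mul]
    simp only [map_add, section5_intCast_mul]
    push_cast
    ring
  have hbase : ∀ k ≤ 4, section5 0 (w k) =
      (([-5, 5, -1, -1, 1].getD k 0 : ℤ) : ℤ⟦X⟧) * (X * eulerE 5 ^ 5) := by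
    intro k hk
    rw [← section5_X_mul_eulerE_pow_mul k hk]
    congr 1
    rw [← eulerE_mul_eulerQuot, hw]
    obtain ⟨l, hl⟩ := Nat.exists_eq_add_of_le hk
    have : eulerE 1 ^ 4 = eulerE 1 ^ k * eulerE 1 ^ (4 - k) := by rw [← pow_add]; congr 1; omega
    simp only [this, ← eulerE_mul_eulerQuot]
    ring
  have hshift : ∀ i, section5 0 (w (i + 4)) = X * eulerE 5 ^ 5 * section5 0 (eulerQuot ^ i) := by
    intro i
    rw [← section5_expand_mul, expand_five_X_mul_eulerE, ← eulerE_mul_eulerQuot]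
    congr 1
    simp only [hw, ← eulerE_mul_eulerQuot]
    ring
  have hne : X * eulerE 5 ^ 5 ≠ 0 :=
    mul_ne_zero X_ne_zero (pow_ne_zero 5 (eulerE_ne_zero (by norm_num)))
  have w0 := hbase 0 (by norm_num)
  have w1 := hbase 1 (by norm_num)
  have w2 := hbase 2 (by norm_num)
  have w3 := hbase 3 (by norm_num)
  have w4 := hbase 4 (by norm_num)
  simp only [List.getD_cons_zero, List.getD_cons_succ] at w0 w1 w2 w3 w4
  push_cast at w0 w1 w2 w3 w4
  -- The explicit rows of M are generated by the same recurrence from the seeds -5, 5, -1, -1, 1;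
  -- here 25 - 25 - 15 + 25 - 5 = 5.
  have h1 : section5 0 (eulerQuot ^ 1) = 5 * eulerQuotSix := by
    apply mul_left_cancel₀ hne
    rw [← hshift, hrec 0, w0, w1, w2, w3, w4]
    ring
  have w5 := hshift 1
  rw [h1] at w5
  have h2 : section5 0 (eulerQuot ^ 2) = 10 * eulerQuotSix + 125 * eulerQuotSix ^ 2 := by
    apply mul_left_cancel₀ hne
    rw [← hshift, hrec 1, w1, w2, w3, w4, w5]
    ring
  have w6 := hshift 2
  rw [h2] at w6
  have h3 : section5 0 (eulerQuot ^ 3) =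
      9 * eulerQuotSix + 375 * eulerQuotSix ^ 2 + 3125 * eulerQuotSix ^ 3 := by
    apply mul_left_cancel₀ hne
    rw [← hshift, hrec 2, w2, w3, w4, w5, w6]
    ring
  have w7 := hshift 3
  rw [h3] at w7
  have h4 : section5 0 (eulerQuot ^ 4) = 4 * eulerQuotSix + 550 * eulerQuotSix ^ 2
      + 12500 * eulerQuotSix ^ 3 + 78125 * eulerQuotSix ^ 4 := by
    apply mul_left_cancel₀ hne
    rw [← hshift, hrec 3, w3, w4, w5, w6, w7]
    ring
  have w8 := hshift 4
  rw [h4] at w8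
  have h5 : section5 0 (eulerQuot ^ 5) = eulerQuotSix + 500 * eulerQuotSix ^ 2
      + 25000 * eulerQuotSix ^ 3 + 390625 * eulerQuotSix ^ 4 + 1953125 * eulerQuotSix ^ 5 := by
    apply mul_left_cancel₀ hne
    rw [← hshift, hrec 4, w4, w5, w6, w7, w8]
    ring
  induction i using Nat.strong_induction_on with
  | _ i ih =>
    intro N hN
    obtain ⟨k, rfl⟩ := Nat.exists_eq_add_of_lt hN
    rcases Nat.lt_or_ge i 6 with h6 | h6
    · interval_cases i
      · rw [h1, show 1 + k + 1 = k + 1 + 1 by ring]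
        simp only [Finset.sum_range_succ']
        simp [m]
      · rw [h2, show 2 + k + 1 = k + 1 + 1 + 1 by ring]
        simp only [Finset.sum_range_succ']
        simp [m]
        ring
      · rw [h3, show 3 + k + 1 = k + 1 + 1 + 1 + 1 by ring]
        simp only [Finset.sum_range_succ']
        simp [m]
        ring
      · rw [h4, show 4 + k + 1 = k + 1 + 1 + 1 + 1 + 1 by ring]
        simp only [Finset.sum_range_succ']
        simp [m]
        ring
      · rw [h5, show 5 + k + 1 = k + 1 + 1 + 1 + 1 + 1 + 1 by ring]
        simp only [Finset.sum_range_succ']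
        simp [m]
        ring
    · obtain ⟨l, rfl⟩ := Nat.exists_eq_add_of_le' h6
      rw [sum_m_succ, ← ih (l + 5) (by omega) (by omega) _ (by omega),
        ← ih (l + 4) (by omega) (by omega) _ (by omega),
        ← ih (l + 3) (by omega) (by omega) _ (by omega),
        ← ih (l + 2) (by omega) (by omega) _ (by omega),
        ← ih (l + 1) (by omega) (by omega) _ (by omega)]
      apply mul_left_cancel₀ hne
      rw [← hshift, show l + 6 + 4 = (l + 5) + 5 by ring, hrec]
      simp only [show ∀ a, l + 5 + a = l + 1 + a + 4 by intro a; ring]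
      rw [show l + 5 = l + 1 + 0 + 4 by ring]
      simp only [hshift]
      ring

/-! ### The passage from α to α+1. -/

theorem m_eq_zero_of_lt (i j : ℕ) (h : i < j) : m i j = 0 := by
  fun_induction m i j <;> grind

/-- For `e = 2` and `e = 1` these are the series on the right-hand side of the theorem for odd and
for even `α`, with `i = k + 1`. -/
noncomputable def eulerTerm (e k : ℕ) : ℤ⟦X⟧ :=
  X ^ k * (eulerE 5 ^ (6 * k + 3 + e) * eulerEInv 1 ^ (6 * k + e))

/-- Multiplying by q^(5k+e) turns the term into ζ^(6k+e) times a series in q^5, so row 6k+e of M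
applies. That row is supported on columns k+1 to 6k+e, which explains both the shift by k+1 and the
bound on `N`. The outer factor then exchanges the two families of terms. -/
theorem section5_eulerTerm {e f : ℕ} (he : 1 ≤ e) (hf : 1 ≤ f) (hef : e + f = 3) {k N : ℕ}
    (hN : 5 * k + e ≤ N) :
    section5 (5 - e) (eulerTerm e k) =
      ∑ j ∈ Finset.range N, (m (6 * k + e) (k + 1 + j) : ℤ⟦X⟧) * eulerTerm f j := by
  set J := expand 5 (by norm_num) (eulerEInv 1)
  have hJ : eulerE 5 * J = 1 := expand_eulerEInv
  have hI := eulerE_mul_eulerEInv one_pos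
  have hJ' : eulerE 25 * expand 5 (by norm_num) J = 1 := by
    have h := congrArg (expand 5 (by norm_num)) hJ
    rwa [map_mul, map_one, expand_eulerE _ (by norm_num)] at h
  have h1 : X ^ (5 * k + e) * eulerTerm e k =
      expand 5 (by norm_num) (eulerE 1 ^ (6 * k + 3 + e) * J ^ (6 * k + e)) *
        eulerQuot ^ (6 * k + e) := by
    rw [eulerTerm, map_mul, map_pow, map_pow, expand_eulerE _ one_pos, mul_one, eulerQuot]
    calc _ = (eulerE 25 * expand 5 (by norm_num) J) ^ (6 * k + e) * (X ^ (5 * k + e) *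
          (X ^ k * (eulerE 5 ^ (6 * k + 3 + e) * eulerEInv 1 ^ (6 * k + e)))) := by
          rw [hJ', one_pow, one_mul]
      _ = _ := by ring
  apply mul_left_cancel₀ (pow_ne_zero (k + 1) (X_ne_zero (R := ℤ)))
  rw [← section5_X_pow_mul (s := 5 * k + e) (k + 1) _ (by omega) (by omega), h1,
    section5_expand_mul, section5_eulerQuot_pow _ (by omega) (k + 1 + N) (by omega),
    Finset.sum_range_add, Finset.sum_eq_zero (s := Finset.range (k + 1)), zero_add,
    Finset.mul_sum, Finset.mul_sum]
  · refine Finset.sum_congr rfl fun j _ => ?_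
    have hτ : eulerE 1 ^ (6 * k + 3 + e) * J ^ (6 * k + e) * eulerQuotSix ^ (k + 1 + j) =
        X ^ (k + 1) * eulerTerm f j := by
      have hp : 6 * (k + 1 + j) = 6 * j + f + (6 * k + 3 + e) := by omega
      have hq : 6 * (k + 1 + j) = 6 * j + 3 + f + (6 * k + e) := by omega
      rw [eulerQuotSix, eulerTerm, mul_pow, mul_pow, ← pow_mul, ← pow_mul]
      nth_rewrite 2 [hp]
      rw [hq]
      calc _ = (eulerE 1 * eulerEInv 1) ^ (6 * k + 3 + e) * (eulerE 5 * J) ^ (6 * k + e) *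
            (X ^ (k + 1) * (X ^ j * (eulerE 5 ^ (6 * j + 3 + f) * eulerEInv 1 ^ (6 * j + f)))) := by
            ring
        _ = _ := by rw [hI, hJ, one_pow, one_pow, one_mul, one_mul]
    linear_combination (m (6 * k + e) (k + 1 + j) : ℤ⟦X⟧) * hτ
  · intro j hj
    rw [Finset.mem_range] at hj
    rw [m_eq_zero _ _ (by omega), Int.cast_zero, zero_mul]

theorem rowMul_eq_sum {x : ℕ+ → ℤ} {N : ℕ} (hx : ∀ k, N ≤ k → x k.succPNat = 0)
    (T : Matrix ℕ+ ℕ+ ℤ) (j : ℕ+) :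
    rowMul x T j = ∑ k ∈ Finset.range N, x k.succPNat * T k.succPNat j := by
  rw [rowMul, ← finsum_comp_equiv Equiv.pnatEquivNat.symm]
  refine finsum_eq_sum_of_support_subset _ fun k hk => ?_
  by_contra h
  simp only [Finset.coe_range, Set.mem_Iio, not_lt] at h
  exact hk (by simp [hx k h])

theorem matA_succPNat (k j : ℕ) : matA k.succPNat j.succPNat = m (6 * k + 2) (k + 1 + j) := by
  simp only [matA, Nat.succPNat_coe, Nat.succ_eq_add_one]
  congr 1
  omega

theorem matB_succPNat (k j : ℕ) : matB k.succPNat j.succPNat = m (6 * k + 1) (k + 1 + j) := by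
  simp only [matB, Nat.succPNat_coe, Nat.succ_eq_add_one]
  congr 1
  omega

theorem section5_sum_eulerTerm {e f : ℕ} (he : 1 ≤ e) (hf : 1 ≤ f) (hef : e + f = 3)
    {T : Matrix ℕ+ ℕ+ ℤ} (hT : ∀ k j : ℕ, T k.succPNat j.succPNat = m (6 * k + e) (k + 1 + j))
    {x : ℕ+ → ℤ} {N : ℕ} (hx : ∀ k, N ≤ k → x k.succPNat = 0) :
    (∀ j, 5 * N + e ≤ j → rowMul x T j.succPNat = 0) ∧
    section5 (5 - e) (∑ k ∈ Finset.range N, (x k.succPNat : ℤ⟦X⟧) * eulerTerm e k) =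
      ∑ j ∈ Finset.range (5 * N + e), (rowMul x T j.succPNat : ℤ⟦X⟧) * eulerTerm f j := by
  constructor
  · intro j hj
    rw [rowMul_eq_sum hx]
    refine Finset.sum_eq_zero fun k hk => ?_
    rw [Finset.mem_range] at hk
    rw [hT, m_eq_zero_of_lt _ _ (by omega), mul_zero]
  · rw [map_sum]
    simp only [rowMul_eq_sum hx, hT, Int.cast_sum, Finset.sum_mul]
    rw [Finset.sum_comm]
    refine Finset.sum_congr rfl fun k hk => ?_
    rw [Finset.mem_range] at hk
    rw [section5_intCast_mul, section5_eulerTerm he hf hef (N := 5 * N + e) (by omega),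
      Finset.mul_sum]
    refine Finset.sum_congr rfl fun j _ => ?_
    push_cast
    ring

theorem delta_succ_of_odd {α : ℕ} (h : Odd α) : delta (α + 1) = delta α + 5 ^ α * 3 := by
  have h1 := delta_odd h
  have h2 := delta_even h.add_one
  rw [pow_succ] at h2
  have := Nat.one_le_pow α 5 (by norm_num)
  omega

theorem delta_succ_of_even {α : ℕ} (h : Even α) : delta (α + 1) = delta α + 5 ^ α * 4 := by
  have h1 := delta_even h
  have h2 := delta_odd h.add_one
  rw [pow_succ] at h2
  have := Nat.one_le_pow α 5 (by norm_num)
  omega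

theorem mk_c_succ {α r : ℕ} (h : delta (α + 1) = delta α + 5 ^ α * r) :
    (mk fun n => c (5 ^ (α + 1) * n + delta (α + 1))) =
      section5 r (mk fun n => c (5 ^ α * n + delta α)) := by
  ext n
  rw [coeff_mk, coeff_section5, coeff_mk, h]
  congr 1
  ring

/-- The case α = 0 is E_5^4/E_1 = `eulerTerm 1 0`, so one even step gives the start, and the 5 is
m_{1,1}. -/
theorem mk_c_one : (mk fun n => c (5 ^ 1 * n + delta 1)) = 5 * eulerTerm 2 0 := by
  have h0 : (mk fun n => c (5 ^ 0 * n + delta 0)) = eulerTerm 1 0 := by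
    ext n
    simp [delta, c, eulerTerm]
  rw [mk_c_succ (α := 0) (r := 4) (delta_succ_of_even (by simp)), h0,
    section5_eulerTerm (e := 1) (f := 2) (N := 1) (by norm_num) (by norm_num) (by norm_num)
      (by norm_num)]
  simp [m]

/-- Carrying the finite support of the row vector through the induction keeps every sum finite, so
exchanging summations needs no convergence argument. -/
theorem exists_mk_c_eq_sum (α : ℕ) (hα : 1 ≤ α) :
    ∃ N, (∀ k, N ≤ k → xVec α k.succPNat = 0) ∧
      (mk fun n => c (5 ^ α * n + delta α)) =
        ∑ k ∈ Finset.range N, (xVec α k.succPNat : ℤ⟦X⟧) *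
          eulerTerm (if Odd α then 2 else 1) k := by
  induction α, hα using Nat.le_induction with
  | base =>
    refine ⟨1, fun k hk => ?_, ?_⟩
    · rw [xVec]
      refine if_neg fun h => ?_
      have := congrArg PNat.val h
      simp at this
      omega
    · have h1 : xVec 1 (Nat.succPNat 0) = 5 := by
        rw [xVec]
        exact if_pos rfl
      rw [mk_c_one]
      simp [h1]
  | succ α hα ih =>
    obtain ⟨N, hN, h⟩ := ih
    obtain ⟨β, rfl⟩ := Nat.exists_eq_add_of_le' hα
    by_cases hodd : Odd (β + 1)
    · have hodd' : ¬ Odd (β + 1 + 1) := by simpa using hodd.add_one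
      have hx : xVec (β + 1 + 1) = rowMul (xVec (β + 1)) matA := by rw [xVec, if_pos hodd]
      have key := section5_sum_eulerTerm (e := 2) (f := 1) (by norm_num) (by norm_num) (by norm_num)
        matA_succPNat hN
      rw [if_pos hodd] at h
      rw [if_neg hodd', hx, mk_c_succ (delta_succ_of_odd hodd), h]
      exact ⟨_, key⟩
    · have heven := Nat.not_odd_iff_even.mp hodd
      have hx : xVec (β + 1 + 1) = rowMul (xVec (β + 1)) matB := by rw [xVec, if_neg hodd]
      have key := section5_sum_eulerTerm (e := 1) (f := 2) (by norm_num) (by norm_num) (by norm_num)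
        matB_succPNat hN
      rw [if_neg hodd] at h
      rw [if_pos heven.add_one, hx, mk_c_succ (delta_succ_of_even heven), h]
      exact ⟨_, key⟩

end HirschhornHunt

theorem theorem1p2 (α : ℕ) (hα : 1 ≤ α) :
    (Odd α →
      HasSum
        (fun i : ℕ+ =>
          PowerSeries.C (HirschhornHunt.xVec α i) * PowerSeries.X ^ ((i : ℕ) - 1) *
            (HirschhornHunt.eulerE 5 ^ (6 * (i : ℕ) - 1) *
              HirschhornHunt.eulerEInv 1 ^ (6 * (i : ℕ) - 4)))
        (PowerSeries.mk fun n : ℕ =>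
          HirschhornHunt.c (5 ^ α * n + HirschhornHunt.delta α))) ∧
    (Even α →
      HasSum
        (fun i : ℕ+ =>
          PowerSeries.C (HirschhornHunt.xVec α i) * PowerSeries.X ^ ((i : ℕ) - 1) *
            (HirschhornHunt.eulerE 5 ^ (6 * (i : ℕ) - 2) *
              HirschhornHunt.eulerEInv 1 ^ (6 * (i : ℕ) - 5)))
        (PowerSeries.mk fun n : ℕ =>
          HirschhornHunt.c (5 ^ α * n + HirschhornHunt.delta α))) := by
  obtain ⟨N, hN, h⟩ := HirschhornHunt.exists_mk_c_eq_sum α hα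
  rw [h]
  have hsum := fun e => hasSum_sum_of_ne_finset_zero (s := Finset.range N)
    (f := fun k : ℕ => (HirschhornHunt.xVec α k.succPNat : ℤ⟦X⟧) * HirschhornHunt.eulerTerm e k)
    (fun k hk => by rw [hN k (by simpa using hk), Int.cast_zero, zero_mul])
    (L := SummationFilter.unconditional ℕ)
  refine ⟨fun hodd => ?_, fun heven => ?_⟩
  · rw [if_pos hodd, ← Equiv.pnatEquivNat.symm.hasSum_iff]
    convert hsum 2 using 2 with k
    simp only [Function.comp_apply, Equiv.pnatEquivNat_symm_apply, Nat.succPNat_coe,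
      Nat.succ_eq_add_one, HirschhornHunt.eulerTerm, Nat.add_sub_cancel, mul_assoc, eq_intCast]
    rw [show 6 * (k + 1) - 1 = 6 * k + 3 + 2 by omega, show 6 * (k + 1) - 4 = 6 * k + 2 by omega]
  · rw [if_neg (Nat.not_odd_iff_even.mpr heven), ← Equiv.pnatEquivNat.symm.hasSum_iff]
    convert hsum 1 using 2 with k
    simp only [Function.comp_apply, Equiv.pnatEquivNat_symm_apply, Nat.succPNat_coe,
      Nat.succ_eq_add_one, HirschhornHunt.eulerTerm, Nat.add_sub_cancel, mul_assoc, eq_intCast]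
    rw [show 6 * (k + 1) - 2 = 6 * k + 3 + 1 by omega, show 6 * (k + 1) - 5 = 6 * k + 1 by omega]
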